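/- Let $F:\mathbf{Set}\to\mathbf{Set}$ be an analytic functor, i.e. $F(X)=\bigsqcup_{i\in I}X^{U_i}/H_i$ and $F(f)(i,[\phi])=(i,[f\circ\phi])$, where every $U_i$ is a finite set, $H_i\le\mathrm{Sym}(U_i)$, and $\sigma\in H_i$ acts by $\sigma\cdot\phi=\phi\circ\sigma^{-1}$. Let $F'(X)=\bigsqcup_{i\in I}\big(\bigsqcup_{u\in U_i}X^{U_i\setminus\{u\}}\big)/H_i$ be its derivative, where $\sigma\cdot(u,\phi)=(\sigma(u),\phi\circ\sigma^{-1}|_{U_i\setminus\{\sigma(u)\}})$, let $\triangleright_X:F'X\times X\to FX$, $((i,[u,\phi]),x)\mapsto(i,[\phi\cup\{\langle u,x\rangle\}])$, be the plug-in, and let $G(X)=(F'X)^\omega$. For an $(F+G)$-algebra $(C,\gamma=[\gamma_0,\gamma_1])$ put $\mathrm{br}_\gamma=\triangleright_C\circ\langle\mathrm{head},\gamma_1\circ\mathrm{tail}\rangle:GC\to FC$, and call the algebra coherent if $$\gamma_1=\gamma_0\circ\mathrm{br}_\gamma.\qquad(\dagger)$$ Let $(A,\alpha)$ be the initial $(F+G)$-algebra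 and $(Z,\zeta)$ the final $F$-coalgebra; its elements are called behaviours. Let $[\![-]\!]:A\to Z$ be the unique $F$-coalgebra morphism from $(A,[\mathrm{id}_{FA},\mathrm{br}_\alpha]\circ\alpha^{-1})$ to $(Z,\zeta)$, and let $\bar Z=\{[\![a]\!]\mid a\in A\}$ be the set of constructible behaviours. Let $\beta=[\beta_0,\beta_1]:FZ+GZ\to Z$, where $\beta_0=\zeta^{-1}$ and $[\mathrm{id}_Z,\beta_1]$ is the unique $F$-coalgebra morphism to $(Z,\zeta)$ from $Z+GZ$ with the structure $[\xi_0,\xi_1]$, $\xi_0=F(\mathrm{in}_1)\circ\zeta$ and $\xi_1=\triangleright_{Z+GZ}\circ(F'(\mathrm{in}_1)\times \mathrm{in}_2)\circ\langle\mathrm{head},\mathrm{tail}\rangle$. The set $\bar Z$ is closed under $\beta$; let $(\bar Z,\bar\beta)$ be the corresponding subalgebra of $(Z,\beta)$. Let $(A^{\approx},\alpha^{\approx})$ be the quotient of $(A,\alpha)$ by the least $(F+G)$-congruence $\approx$ with $\alpha_1(s)\approx\alpha_0(\mathrm{br}_\alpha(s))$ for all $s\in GA$. For $z\in Z$ with $\zeta(z)=(i,[\phi])$,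 let $\mathrm{Suc}(z)$ be the set of pairs $(z',k)$ with $z'\in Z$, $k\in\omega$ and $k<|\phi^{-1}(z')|$. Call $z$ thin if there are at most countably many infinite paths from $z$, i.e. sequences $z_0k_1z_1k_2z_2\dots$ with $z_0=z$ and $(z_{n+1},k_{n+1})\in\mathrm{Suc}(z_n)$ for all $n$. Then: 1. The $(F+G)$-algebras $(\bar Z,\bar\beta)$ and $(A^{\approx},\alpha^{\approx})$ are isomorphic. 2. A behaviour is thin if and only if it is constructible. 3. The set of thin behaviours is closed under $\beta$, and the subalgebra of $(Z,\beta)$ on it is an initial coherent $(F+G)$-algebra: it is coherent and has a unique $(F+G)$-algebra morphism to every coherent $(F+G)$-algebra. -/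

import Mathlib

open CategoryTheory CategoryTheory.Endofunctor

universe u

noncomputable section

/-- The data of an analytic functor `X ↦ ⨆ i, X ^ (U i) / H i` on the category of sets: every `U i`
is a finite set and every `H i` is a subgroup of the group of permutations of `U i`. -/
structure AnalyticFunctor where
  /-- the index set -/
  I : Type u
  /-- the positions -/
  U : I → Type u
  finite_U : ∀ i, Finite (U i)
  /-- the permutation groups -/
  H : ∀ i, Subgroup (Equiv.Perm (U i))

namespace AnalyticFunctor

variable (F : AnalyticFunctor.{u}) {X Y W : Type u}

/-! ### The functor -/

/-- The orbit relation of the action `σ • φ = φ ∘ σ⁻¹` of `H i` on functions `φ : U i → X`. -/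
def orbitRel (i : F.I) (X : Type u) : Setoid (F.U i → X) where
  r φ ψ := ∃ σ ∈ F.H i, ψ = φ ∘ ⇑(σ⁻¹)
  iseqv :=
    { refl := fun φ => ⟨1, (F.H i).one_mem, by ext; simp⟩
      symm := by
        rintro φ ψ ⟨σ, hσ, rfl⟩
        exact ⟨σ⁻¹, (F.H i).inv_mem hσ, by ext; simp⟩
      trans := by
        rintro φ ψ χ ⟨σ, hσ, rfl⟩ ⟨τ, hτ, rfl⟩
        exact ⟨τ * σ, (F.H i).mul_mem hτ hσ, by ext; simp⟩ }

/-- `F X`, the disjoint union of the orbit sets `X ^ (U i) / H i`. -/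
def Obj (X : Type u) : Type u := Σ i : F.I, Quotient (F.orbitRel i X)

/-- `F f (i, [φ]) = (i, [f ∘ φ])`. -/
def map (f : X → Y) (x : F.Obj X) : F.Obj Y :=
  ⟨x.1, Quotient.map (fun φ => f ∘ φ)
    (by rintro φ ψ ⟨σ, hσ, rfl⟩; exact ⟨σ, hσ, rfl⟩) x.2⟩

theorem map_id (x : F.Obj X) : F.map id x = x := by
  obtain ⟨i, ⟨φ⟩⟩ := x; rfl

theorem map_comp (f : X → Y) (g : Y → W) (x : F.Obj X) :
    F.map (g ∘ f) x = F.map g (F.map f x) := by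
  obtain ⟨i, ⟨φ⟩⟩ := x; rfl

/-- The analytic functor as an endofunctor of the category of sets. -/
def functor : Type u ⥤ Type u where
  obj := F.Obj
  map f := ↾(F.map f)
  map_id X := by ext x; exact F.map_id x
  map_comp f g := by ext x; exact F.map_comp f g x

/-! ### The functor derivative and the plug-in -/

/-- Pairs `(u, φ)` of a hole `u ∈ U i` and a function `φ : U i ∖ {u} → X`. -/
abbrev Holed (i : F.I) (X : Type u) : Type u := Σ u : F.U i, ({v : F.U i // v ≠ u} → X)

/-- `σ • (u, φ) = (σ u, φ ∘ σ⁻¹)`, the second component restricted to `U i ∖ {σ u}`. -/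
def holedAct {i : F.I} (σ : Equiv.Perm (F.U i)) (p : F.Holed i X) : F.Holed i X :=
  ⟨σ p.1, fun v => p.2 ⟨σ⁻¹ v.1, fun h => v.2 (Equiv.Perm.inv_eq_iff_eq.1 h)⟩⟩

theorem holed_ext {i : F.I} {p q : F.Holed i X} (h : p.1 = q.1)
    (h' : ∀ v hv hv', p.2 ⟨v, hv⟩ = q.2 ⟨v, hv'⟩) : p = q := by
  obtain ⟨u, φ⟩ := p
  obtain ⟨w, ψ⟩ := q
  obtain rfl : u = w := h
  congr 1
  ext v
  exact h' v.1 v.2 v.2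

/-- The orbit relation of the action of `H i` on `⨆ u, X ^ (U i ∖ {u})`. -/
def holedRel (i : F.I) (X : Type u) : Setoid (F.Holed i X) where
  r p q := ∃ σ ∈ F.H i, q = F.holedAct σ p
  iseqv :=
    { refl := fun p => ⟨1, (F.H i).one_mem, F.holed_ext rfl (fun _ _ _ => rfl)⟩
      symm := by
        rintro p q ⟨σ, hσ, rfl⟩
        refine ⟨σ⁻¹, (F.H i).inv_mem hσ, F.holed_ext (by simp [holedAct]) ?_⟩
        intro v hv hv'
        exact congrArg p.2 (Subtype.ext (by simp))
      trans := by
        rintro p q r ⟨σ, hσ, rfl⟩ ⟨τ, hτ, rfl⟩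
        exact ⟨τ * σ, (F.H i).mul_mem hτ hσ, F.holed_ext rfl (fun _ _ _ => rfl)⟩ }

/-- `F' X`, the set of contexts `(i, [u, φ])` over `X`. -/
def DObj (X : Type u) : Type u := Σ i : F.I, Quotient (F.holedRel i X)

/-- `F' f (i, [u, φ]) = (i, [u, f ∘ φ])`. -/
def dmap (f : X → Y) (x : F.DObj X) : F.DObj Y :=
  ⟨x.1, Quotient.map (fun p => ⟨p.1, f ∘ p.2⟩)
    (by rintro p q ⟨σ, hσ, rfl⟩; exact ⟨σ, hσ, rfl⟩) x.2⟩

theorem dmap_id (x : F.DObj X) : F.dmap id x = x := by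
  obtain ⟨i, ⟨φ⟩⟩ := x; rfl

theorem dmap_comp (f : X → Y) (g : Y → W) (x : F.DObj X) :
    F.dmap (g ∘ f) x = F.dmap g (F.dmap f x) := by
  obtain ⟨i, ⟨φ⟩⟩ := x; rfl

/-- The functor derivative `F'` as an endofunctor of the category of sets. -/
def derivative : Type u ⥤ Type u where
  obj := F.DObj
  map f := ↾(F.dmap f)
  map_id X := by ext x; exact F.dmap_id x
  map_comp f g := by ext x; exact F.dmap_comp f g x

open Classical in
/-- `φ ∪ {⟨u, x⟩}`: fill the hole `u` with `x`. -/
def fill {i : F.I} (p : F.Holed i X) (x : X) : F.U i → X :=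
  fun v => if h : v = p.1 then x else p.2 ⟨v, h⟩

theorem fill_act {i : F.I} (σ : Equiv.Perm (F.U i)) (p : F.Holed i X) (x : X) :
    F.fill (F.holedAct σ p) x = F.fill p x ∘ ⇑(σ⁻¹) := by
  ext v
  have h : v = σ p.1 ↔ σ⁻¹ v = p.1 := by
    rw [Equiv.Perm.inv_eq_iff_eq]
  by_cases hv : v = σ p.1
  · have hv' := h.1 hv
    exact (dif_pos hv).trans (Eq.symm (dif_pos (c := σ⁻¹ v = p.1) hv'))
  · have hv' : ¬ σ⁻¹ v = p.1 := fun hh => hv (h.2 hh)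
    exact (dif_neg hv).trans (Eq.symm (dif_neg (c := σ⁻¹ v = p.1) hv'))

/-- The plug-in `((i, [u, φ]), x) ↦ (i, [φ ∪ {⟨u, x⟩}])`. -/
def plug (c : F.DObj X) (x : X) : F.Obj X :=
  ⟨c.1, Quotient.map (sb := F.orbitRel c.1 X) (fun p => F.fill p x)
    (by rintro p q ⟨σ, hσ, rfl⟩; exact ⟨σ, hσ, F.fill_act σ p x⟩) c.2⟩

/-- The plug-in is natural. -/
theorem map_plug (f : X → Y) (c : F.DObj X) (x : X) :
    F.map f (F.plug c x) = F.plug (F.dmap f c) (f x) := by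
  obtain ⟨i, ⟨p⟩⟩ := c
  have h : f ∘ F.fill p x = F.fill (⟨p.1, f ∘ p.2⟩ : F.Holed i Y) (f x) := by
    ext v
    by_cases hv : v = p.1
    · simp only [fill, Function.comp_apply, dif_pos hv]
    · simp only [fill, Function.comp_apply, dif_neg hv]
  exact congrArg (fun φ => (⟨i, Quotient.mk (F.orbitRel i Y) φ⟩ : F.Obj Y)) h

/-! ### The functors `G = (F' -)^ω` and `F + G` -/

/-- `G X = (F' X)^ω`, the streams of contexts over `X`. -/
def GObj (X : Type u) : Type u := ℕ → F.DObj X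

/-- The action of `G` on functions. -/
def gmap (f : X → Y) (s : F.GObj X) : F.GObj Y := fun n => F.dmap f (s n)

/-- The head of a stream of contexts. -/
def head (s : F.GObj X) : F.DObj X := s 0

/-- The tail of a stream of contexts. -/
def tail (s : F.GObj X) : F.GObj X := fun n => s (n + 1)

/-- `(F + G) X`. -/
def TObj (X : Type u) : Type u := F.Obj X ⊕ F.GObj X

/-- The action of `F + G` on functions. -/
def tmap (f : X → Y) : F.TObj X → F.TObj Y := Sum.map (F.map f) (F.gmap f)

theorem tmap_id (x : F.TObj X) : F.tmap id x = x := by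
  rcases x with x | s
  · exact congrArg Sum.inl (F.map_id x)
  · exact congrArg Sum.inr (funext fun n => F.dmap_id (s n))

theorem tmap_comp (f : X → Y) (g : Y → W) (x : F.TObj X) :
    F.tmap (g ∘ f) x = F.tmap g (F.tmap f x) := by
  rcases x with x | s
  · exact congrArg Sum.inl (F.map_comp f g x)
  · exact congrArg Sum.inr (funext fun n => F.dmap_comp f g (s n))

/-- `F + G` as an endofunctor of the category of sets. -/
def sumFunctor : Type u ⥤ Type u where
  obj := F.TObj
  map f := ↾(F.tmap f)
  map_id X := by ext x; exact F.tmap_id x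
  map_comp f g := by ext x; exact F.tmap_comp f g x

/-! ### The initial `(F + G)`-algebra and the final `F`-coalgebra

Both are obtained from the fixed points of quotients of polynomial functors. -/

instance qpfObj : QPF F.Obj where
  map := F.map
  P := ⟨F.I, F.U⟩
  abs p := ⟨p.1, Quotient.mk _ p.2⟩
  repr x := ⟨x.1, x.2.out⟩
  abs_repr x := by
    obtain ⟨i, φ⟩ := x
    exact congrArg (Sigma.mk i) (Quotient.out_eq φ)
  abs_map _ _ := rfl

/-- A polynomial functor of which `F + G` is a quotient. -/
def tPoly : PFunctor.{u, u} where
  A := F.I ⊕ (ℕ → Σ i, F.U i)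
  B := Sum.elim F.U (fun s => Σ n : ℕ, {v : F.U (s n).1 // v ≠ (s n).2})

/-- The quotient map from the polynomial functor to `F + G`. -/
def tAbs : F.tPoly X → F.TObj X
  | ⟨.inl i, φ⟩ => .inl ⟨i, Quotient.mk (F.orbitRel i X) φ⟩
  | ⟨.inr s, φ⟩ => .inr fun n =>
      ⟨(s n).1, Quotient.mk (F.holedRel (s n).1 X) ⟨(s n).2, fun v => φ ⟨n, v⟩⟩⟩

/-- A choice of representatives. -/
def tRepr : F.TObj X → F.tPoly X
  | .inl x => ⟨.inl x.1, x.2.out⟩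
  | .inr s => ⟨.inr fun n => ⟨(s n).1, (s n).2.out.1⟩, fun v => (s v.1).2.out.2 v.2⟩

instance qpfTObj : QPF F.TObj where
  map := F.tmap
  P := F.tPoly
  abs := F.tAbs
  repr := F.tRepr
  abs_repr x := by
    rcases x with ⟨i, φ⟩ | s
    · exact congrArg (fun q => (Sum.inl (⟨i, q⟩ : F.Obj _) : F.TObj _)) (Quotient.out_eq φ)
    · exact congrArg (fun s' => (Sum.inr s' : F.TObj _))
        (funext fun n => congrArg (fun q => (⟨(s n).1, q⟩ : F.DObj _)) (Quotient.out_eq (s n).2))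
  abs_map f p := by
    rcases p with ⟨i | s, φ⟩ <;> rfl

/-- The initial `(F + G)`-algebra `(A, α)`; its elements are the terms. -/
def terms : Algebra F.sumFunctor where
  a := QPF.Fix F.TObj
  str := ↾QPF.Fix.mk

/-- The final `F`-coalgebra `(Z, ζ)`; its elements are the behaviours. -/
def behaviours : Coalgebra F.functor where
  V := QPF.Cofix F.Obj
  str := ↾QPF.Cofix.dest

/-- `(A, α)` is initial. -/
def termsIsInitial : Limits.IsInitial F.terms :=
  Limits.IsInitial.ofUniqueHom
    (fun C =>
      { f := ↾(QPF.Fix.rec (F := F.TObj) (fun x => C.str x))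
        h := by
          ext x
          exact (QPF.Fix.rec_eq (F := F.TObj) (fun x => C.str x) x).symm })
    (by
      intro C m
      ext x
      exact (congrFun (QPF.Fix.rec_unique (F := F.TObj) (fun x => C.str x) (fun x => m.f x)
        (fun x => (types_congr_hom m.h x).symm)) x).symm)

/-- `(Z, ζ)` is final. -/
def behavioursIsTerminal : Limits.IsTerminal F.behaviours :=
  Limits.IsTerminal.ofUniqueHom
    (fun T =>
      { f := ↾(QPF.Cofix.corec (F := F.Obj) (fun x => T.str x))
        h := by
          ext x
          exact (QPF.Cofix.dest_corec (F := F.Obj) (fun x => T.str x) x).symm })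
    (by
      intro T m
      ext x
      refine QPF.Cofix.bisim_rel (F := F.Obj)
        (fun a b => ∃ t : T.V, a = m.f t ∧ b = QPF.Cofix.corec (F := F.Obj) (fun x => T.str x) t)
        ?_ _ _ ⟨x, rfl, rfl⟩
      rintro _ _ ⟨t, rfl, rfl⟩
      have h : QPF.Cofix.dest (F := F.Obj) (m.f t) = F.map (fun x => m.f x) (T.str t) :=
        (types_congr_hom m.h t).symm
      refine (congrArg (F.map (Quot.mk _)) h).trans (Eq.trans ?_
        (congrArg (F.map (Quot.mk _))
          (QPF.Cofix.dest_corec (F := F.Obj) (fun x => T.str x) t)).symm)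
      refine (F.map_comp _ _ _).symm.trans (Eq.trans ?_ (F.map_comp _ _ _))
      exact congrArg (fun f => F.map f (T.str t)) (funext fun t => Quot.sound ⟨t, rfl, rfl⟩))

/-! ### Coherence -/

variable {F}

/-- The component `γ₀ : F C → C` of an algebra structure `[γ₀, γ₁]`. -/
def str₀ (C : Algebra F.sumFunctor) (x : F.Obj C.a) : C.a := C.str (Sum.inl x : F.TObj C.a)

/-- The component `γ₁ : G C → C` of an algebra structure `[γ₀, γ₁]`. -/
def str₁ (C : Algebra F.sumFunctor) (s : F.GObj C.a) : C.a := C.str (Sum.inr s : F.TObj C.a)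

/-- The map `G C → F C` that plugs the evaluation of the tail into the head. -/
def branch (C : Algebra F.sumFunctor) (s : F.GObj C.a) : F.Obj C.a :=
  F.plug (F.head s) (str₁ C (F.tail s))

/-- The coherence equation `γ₁ = γ₀ ∘ branch`. -/
def Coherent (C : Algebra F.sumFunctor) : Prop := ∀ s, str₁ C s = str₀ C (branch C s)

variable (F) in
/-- The category of coherent `(F + G)`-algebras, with all algebra morphisms. -/
abbrev CoherentAlgebra := ObjectProperty.FullSubcategory (Coherent (F := F))

/-! ### Subalgebras and quotient algebras -/

/-- A subset that is closed under the algebra structure. -/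
def IsClosedUnder (C : Algebra F.sumFunctor) (S : Set C.a) : Prop :=
  ∀ x : F.TObj S, C.str (F.tmap (Subtype.val : S → C.a) x) ∈ S

/-- The subalgebra with carrier `S`. -/
def subalgebra (C : Algebra F.sumFunctor) (S : Set C.a) (hS : IsClosedUnder C S) :
    Algebra F.sumFunctor where
  a := S
  str := ↾fun x : F.TObj S => (⟨C.str (F.tmap (Subtype.val : S → C.a) x), hS x⟩ : S)

/-- An equivalence relation on the carrier such that the structure map descends to the quotient. -/
def IsCongruence (C : Algebra F.sumFunctor) (r : Setoid C.a) : Prop :=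
  ∀ x y : F.TObj C.a, F.tmap (Quotient.mk r) x = F.tmap (Quotient.mk r) y →
    r (C.str x) (C.str y)

/-- The structure map on the quotient by `r`: lift to representatives, apply the structure map. -/
def quotientAlgebra (C : Algebra F.sumFunctor) (r : Setoid C.a) : Algebra F.sumFunctor where
  a := Quotient r
  str := ↾fun x : F.TObj (Quotient r) => Quotient.mk r (C.str (F.tmap Quotient.out x))

/-- For a congruence, the projection to the quotient is an algebra morphism. -/
def quotientMap (C : Algebra F.sumFunctor) (r : Setoid C.a) (hr : IsCongruence C r) :
    C ⟶ quotientAlgebra C r where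
  f := ↾(Quotient.mk r)
  h := by
    ext x
    refine Quotient.sound (hr _ _ ?_)
    change F.tmap _ (F.tmap _ (F.tmap _ x)) = _
    rw [← F.tmap_comp]
    have h : (Quotient.mk r ∘ Quotient.out : Quotient r → Quotient r) = id :=
      funext Quotient.out_eq
    rw [h, F.tmap_id]
    rfl

/-- The least congruence that contains all pairs `(γ₁ s, γ₀ (branch s))`. -/
def coherenceCongruence (C : Algebra F.sumFunctor) : Setoid C.a :=
  sInf {r | IsCongruence C r ∧ ∀ s, r (str₁ C s) (str₀ C (branch C s))}

theorem coherenceCongruence_isCongruence (C : Algebra F.sumFunctor) :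
    IsCongruence C (coherenceCongruence C) := by
  intro x y hxy r hr
  have h : (Quotient.mk r : C.a → Quotient r) =
      Quotient.map' (s₁ := coherenceCongruence C) (s₂ := r) id (fun a b hab => hab r hr) ∘
        Quotient.mk (coherenceCongruence C) := rfl
  refine hr.1 x y ?_
  rw [h, F.tmap_comp, F.tmap_comp, hxy]

variable (F) in
/-- The quotient of the initial `(F + G)`-algebra by the coherence equation. -/
def quotientTerms : Algebra F.sumFunctor := quotientAlgebra F.terms (coherenceCongruence F.terms)

variable (F)

/-- The projection from terms to the quotient. -/
def quotientTermsMap : F.terms ⟶ F.quotientTerms :=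
  quotientMap F.terms _ (coherenceCongruence_isCongruence F.terms)

/-- The quotient by the least congruence is the coequaliser, in the category of `(F + G)`-algebras,
of the extensions of `α₁` and `α₀ ∘ branch` to the free algebra over `G A`. -/
theorem quotientTerms_isCoequalizer {Free : Type u ⥤ Algebra F.sumFunctor}
    (adj : Free ⊣ Algebra.forget F.sumFunctor) :
    ∃ w : (adj.homEquiv (F.GObj F.terms.a) F.terms).symm (↾(str₁ F.terms)) ≫ F.quotientTermsMap =
        (adj.homEquiv (F.GObj F.terms.a) F.terms).symm
          (↾(fun s => str₀ F.terms (branch F.terms s))) ≫ F.quotientTermsMap,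
      Nonempty (Limits.IsColimit (Limits.Cofork.ofπ F.quotientTermsMap w)) := by
  have key : ∀ (C : Algebra F.sumFunctor) (m : F.terms ⟶ C),
      (adj.homEquiv (F.GObj F.terms.a) F.terms).symm (↾(str₁ F.terms)) ≫ m =
        (adj.homEquiv (F.GObj F.terms.a) F.terms).symm
          (↾(fun s => str₀ F.terms (branch F.terms s))) ≫ m ↔
      ∀ s, m.f (str₁ F.terms s) = m.f (str₀ F.terms (branch F.terms s)) := by
    intro C m
    rw [← (adj.homEquiv _ _).injective.eq_iff, adj.homEquiv_naturality_right,
      adj.homEquiv_naturality_right, Equiv.apply_symm_apply, Equiv.apply_symm_apply]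
    constructor
    · intro h s
      exact types_congr_hom h s
    · intro h
      ext s
      exact h s
  refine ⟨(key _ _).2 fun s => Quotient.sound fun r hr => hr.2 s, ⟨?_⟩⟩
  refine Limits.Cofork.IsColimit.mk' _ fun c => ?_
  have hc := (key _ _).1 c.condition
  have hmap : ∀ x : F.TObj F.terms.a, c.π.f (F.terms.str x) =
      c.pt.str (F.tmap (fun a => c.π.f a) x) := fun x => (types_congr_hom c.π.h x).symm
  have hker : IsCongruence F.terms (Setoid.ker fun a => c.π.f a) := by
    intro x y hxy
    change c.π.f _ = c.π.f _
    rw [hmap, hmap]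
    have e : (fun a => c.π.f a) =
        Quotient.lift (s := Setoid.ker fun a => c.π.f a) (fun a => c.π.f a) (fun _ _ h => h) ∘
          Quotient.mk _ := rfl
    rw [e, F.tmap_comp, F.tmap_comp, hxy]
  let l : F.quotientTerms.a → c.pt.a :=
    Quotient.lift (s := coherenceCongruence F.terms) (fun a => c.π.f a)
      (fun a b h => h _ ⟨hker, hc⟩)
  have hl : ∀ x : F.TObj F.quotientTerms.a,
      c.pt.str (F.tmap l x) = l (F.quotientTerms.str x) := by
    intro x
    refine Eq.trans ?_ (hmap _).symm
    refine congrArg (fun y => c.pt.str y) (Eq.trans ?_ (F.tmap_comp _ _ _))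
    exact congrArg (fun f => F.tmap f x)
      (funext fun q => congrArg l (Quotient.out_eq q).symm)
  refine ⟨{ f := ↾l, h := by ext x; exact hl x }, ?_, ?_⟩
  · ext a
    rfl
  · intro m hm
    ext q
    obtain ⟨a, rfl⟩ := Quotient.exists_rep q
    exact types_congr_hom (congrArg Algebra.Hom.f hm) a

/-! ### Semantics -/

/-- The coalgebra structure on terms, `[id, branch] ∘ α⁻¹`. -/
def termsCoalgebra : Coalgebra F.functor where
  V := F.terms.a
  str := Algebra.Initial.strInv F.termsIsInitial ≫
    ↾(Sum.elim id (branch F.terms) : F.TObj F.terms.a → F.Obj F.terms.a)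

/-- The operational semantics, the unique coalgebra morphism from terms to behaviours. -/
def operational : F.terms.a → F.behaviours.V :=
  fun a => (F.behavioursIsTerminal.from F.termsCoalgebra).f a

/-- The set of constructible behaviours: those that are represented by a term. -/
def constructible : Set F.behaviours.V := Set.range F.operational

/-- The coalgebra structure `[ξ₀, ξ₁]` on `Z + G Z`. -/
def streamCoalgebra : Coalgebra F.functor where
  V := F.behaviours.V ⊕ F.GObj F.behaviours.V
  str := ↾(Sum.elim
    (fun z => F.map Sum.inl (F.behaviours.str z))
    (fun s => F.plug (F.dmap Sum.inl (F.head s)) (Sum.inr (F.tail s))) :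
      F.behaviours.V ⊕ F.GObj F.behaviours.V → F.Obj (F.behaviours.V ⊕ F.GObj F.behaviours.V))

/-- `β₀ = ζ⁻¹`. -/
def beta₀ (x : F.Obj F.behaviours.V) : F.behaviours.V :=
  Coalgebra.Terminal.strInv F.behavioursIsTerminal x

/-- `β₁`, the second component of the unique coalgebra morphism from `Z + G Z` to `Z`. -/
def beta₁ (s : F.GObj F.behaviours.V) : F.behaviours.V :=
  (F.behavioursIsTerminal.from F.streamCoalgebra).f
    (Sum.inr s : F.behaviours.V ⊕ F.GObj F.behaviours.V)

/-- The `(F + G)`-algebra `(Z, β)`, `β = [β₀, β₁]`. -/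
def behavioursAlgebra : Algebra F.sumFunctor where
  a := F.behaviours.V
  str := ↾(Sum.elim F.beta₀ F.beta₁ : F.TObj F.behaviours.V → F.behaviours.V)

/-- The denotational semantics, the unique algebra morphism from terms to `(Z, β)`. -/
def denotational : F.terms ⟶ F.behavioursAlgebra := F.termsIsInitial.to F.behavioursAlgebra

theorem beta₀_behaviours (z : F.behaviours.V) : F.beta₀ (F.behaviours.str z) = z :=
  types_congr_hom (Coalgebra.Terminal.right_inv F.behavioursIsTerminal) z

theorem behaviours_beta₀ (x : F.Obj F.behaviours.V) : F.behaviours.str (F.beta₀ x) = x :=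
  types_congr_hom (Coalgebra.Terminal.left_inv F.behavioursIsTerminal) x

/-- The first component of the coalgebra morphism from `Z + G Z` to `Z` is the identity. -/
theorem from_streamCoalgebra_inl (z : F.behaviours.V) :
    (F.behavioursIsTerminal.from F.streamCoalgebra).f
      (Sum.inl z : F.behaviours.V ⊕ F.GObj F.behaviours.V) = z := by
  let i : F.behaviours ⟶ F.streamCoalgebra := { f := ↾Sum.inl, h := by ext z; rfl }
  exact types_congr_hom (congrArg Coalgebra.Hom.f
    (F.behavioursIsTerminal.hom_ext (i ≫ F.behavioursIsTerminal.from F.streamCoalgebra) (𝟙 _))) z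

theorem behaviours_beta₁ (s : F.GObj F.behaviours.V) :
    F.behaviours.str (F.beta₁ s) = F.plug (F.head s) (F.beta₁ (F.tail s)) := by
  have h := types_congr_hom (F.behavioursIsTerminal.from F.streamCoalgebra).h
    (Sum.inr s : F.behaviours.V ⊕ F.GObj F.behaviours.V)
  refine h.symm.trans ((F.map_plug _ _ _).trans ?_)
  refine congrArg₂ F.plug ?_ rfl
  refine (F.dmap_comp _ _ _).symm.trans (Eq.trans ?_ (F.dmap_id _))
  exact congrArg (fun f => F.dmap f (F.head s)) (funext F.from_streamCoalgebra_inl)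

theorem denotational_terms (x : F.TObj F.terms.a) :
    F.denotational.f (F.terms.str x) =
      F.behavioursAlgebra.str (F.tmap (fun a => F.denotational.f a) x) :=
  (types_congr_hom F.denotational.h x).symm

/-- The two semantics coincide. -/
theorem denotational_eq_operational (a : F.terms.a) : F.denotational.f a = F.operational a := by
  have hinv : ∀ x : F.TObj F.terms.a,
      Algebra.Initial.strInv F.termsIsInitial (F.terms.str x) = x := fun x =>
    types_congr_hom (Algebra.Initial.right_inv F.termsIsInitial) x
  have hsurj : ∀ a : F.terms.a, ∃ x : F.TObj F.terms.a, F.terms.str x = a := fun a =>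
    ⟨_, types_congr_hom (Algebra.Initial.left_inv F.termsIsInitial) a⟩
  let d : F.termsCoalgebra ⟶ F.behaviours :=
    { f := F.denotational.f
      h := by
        ext a
        obtain ⟨x, rfl⟩ := hsurj a
        have h1 : F.termsCoalgebra.str (F.terms.str x) =
            Sum.elim id (branch F.terms) x :=
          congrArg (Sum.elim id (branch F.terms)) (hinv x)
        change F.map (fun a => F.denotational.f a) (F.termsCoalgebra.str (F.terms.str x)) =
          F.behaviours.str (F.denotational.f (F.terms.str x))
        rw [h1, F.denotational_terms]
        rcases x with x | s
        · exact (F.behaviours_beta₀ _).symm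
        · refine (F.map_plug _ _ _).trans (Eq.trans ?_ (F.behaviours_beta₁ _).symm)
          exact congrArg (F.plug _) (F.denotational_terms (Sum.inr (F.tail s))) }
  exact types_congr_hom (congrArg Coalgebra.Hom.f
    (F.behavioursIsTerminal.hom_ext d (F.behavioursIsTerminal.from F.termsCoalgebra))) a

/-- The constructible behaviours are closed under the algebra structure of `(Z, β)`. -/
theorem constructible_isClosedUnder : IsClosedUnder F.behavioursAlgebra F.constructible := by
  intro x
  choose g hg using fun z : F.constructible => z.2
  have h : (Subtype.val : F.constructible → F.behaviours.V) =
      (fun a => F.denotational.f a) ∘ g := by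
    ext z
    exact ((F.denotational_eq_operational _).trans (hg z)).symm
  refine ⟨F.terms.str (F.tmap g x), ?_⟩
  rw [← F.denotational_eq_operational, F.denotational_terms]
  refine congrArg (fun y => F.behavioursAlgebra.str y) ?_
  refine (F.tmap_comp _ _ _).symm.trans ?_
  rw [← h]
  rfl

/-- The subalgebra of `(Z, β)` of constructible behaviours. -/
def constructibleAlgebra : Algebra F.sumFunctor :=
  subalgebra F.behavioursAlgebra F.constructible F.constructible_isClosedUnder

/-! ### Paths and thin behaviours -/

variable {F}

/-- The multiplicity of `y` in `(i, [φ])`, the cardinality of the fibre of `φ` over `y`. -/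
def multiplicity (x : F.Obj X) (y : X) : ℕ :=
  Quotient.lift (s := F.orbitRel x.1 X) (fun φ => Nat.card {u : F.U x.1 // φ u = y})
    (by
      rintro φ ψ ⟨σ, hσ, rfl⟩
      refine Nat.card_congr (σ.subtypeEquiv fun u => ?_)
      simp) x.2

/-- The pairs `(t', k)` such that `t'` is a successor of `t` with multiplicity greater than `k`.
As the sets `U i` are finite, `t'` is a successor precisely if its multiplicity is positive. -/
def successors (T : Coalgebra F.functor) (t : T.V) : Set (T.V × ℕ) :=
  {p | p.2 < multiplicity (F := F) (T.str t) p.1}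

/-- The infinite paths `t₀ k₁ t₁ k₂ t₂ …` from `t`, given by the sequence of the states `tₙ` and
the sequence of the numbers `kₙ₊₁`. -/
def infinitePaths (T : Coalgebra F.functor) (t : T.V) : Set ((ℕ → T.V) × (ℕ → ℕ)) :=
  {p | p.1 0 = t ∧ ∀ n, (p.1 (n + 1), p.2 n) ∈ successors T (p.1 n)}

/-- A state is thin if there are at most countably many infinite paths from it. -/
def Thin (T : Coalgebra F.functor) (t : T.V) : Prop := (infinitePaths T t).Countable

variable (F)

/-- The set of thin behaviours. -/
def thinBehaviours : Set F.behaviours.V := {z | Thin F.behaviours z}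

end AnalyticFunctor

end

/-!
Two facts about the behaviours of terms carry the theorem.

*Completeness of coherence* (`map_eq_of_operational_eq`): two terms with the same behaviour have
the same value in every coherent algebra. This goes by a nested structural induction on the two
terms. A term `α₀ x` is compared with an unfolding of the other term position by position, after a
permutation in `H i` has matched the representatives. Two stream terms `α₁ s` and `α₁ s'` with the
same behaviour are unfolded in parallel. If the permutations match the holes at every depth, then
the induction hypothesis identifies the contexts of `s` with those of `s'`, hence the values of
the two terms. If at some depth the holes are not matched, then each of the remaining tails is
matched with a component of the other stream, the induction hypothesis applies, and the coherence
equation carries the equality back to the top. Conversely, congruent terms have the same behaviour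
because `(Z, β)` is coherent. So the algebra of constructible behaviours is isomorphic to the
quotient of the terms, and it is the initial coherent algebra.

*The thin behaviours are the constructible ones* (`thinBehaviours_eq_constructible`). Behaviours
of terms are thin by induction: a path from `β₁ s` either visits a thin behaviour, and there are
only countably many such paths (`countable_paths_visiting_thin`), or it follows the holes forever,
in just one way, because a filler that is not thin has multiplicity one. Conversely, a behaviour
that is not constructible always has a successor that is not constructible. If there were only one
such successor, counted with multiplicity, at every state of some path of behaviours that are not
constructible, then the first state would, by coinduction, be `β₁` of a stream of contexts over
constructible behaviours, and so be constructible. Hence a branching into two behaviours that are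
not constructible recurs forever, and the bit streams inject into the paths (`not_thin_of_steer`).
-/

namespace AnalyticFunctor

variable {F : AnalyticFunctor.{u}} {X Y W : Type u}

/-! ### Structures over a set: predicate liftings and equality -/

/-- The lifting of a predicate along `F`: some, equivalently every, representative of `x` has all
its values in `p`. -/
def Obj.All (p : X → Prop) (x : F.Obj X) : Prop :=
  ∃ (i : F.I) (φ : F.U i → X), x = ⟨i, Quotient.mk _ φ⟩ ∧ ∀ v, p (φ v)

/-- The lifting of a predicate along `F'`. -/
def DObj.All (p : X → Prop) (c : F.DObj X) : Prop :=
  ∃ (i : F.I) (q : F.Holed i X), c = ⟨i, Quotient.mk _ q⟩ ∧ ∀ v, p (q.2 v)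

theorem Obj.All.mono {p q : X → Prop} (h : ∀ x, p x → q x) {x : F.Obj X} (hx : Obj.All p x) :
    Obj.All q x :=
  let ⟨i, φ, e, hφ⟩ := hx
  ⟨i, φ, e, fun v => h _ (hφ v)⟩

theorem DObj.All.mono {p q : X → Prop} (h : ∀ x, p x → q x) {c : F.DObj X} (hc : DObj.All p c) :
    DObj.All q c :=
  let ⟨i, φ, e, hφ⟩ := hc
  ⟨i, φ, e, fun v => h _ (hφ v)⟩

theorem Obj.all_map_of_forall {p : Y → Prop} {f : X → Y} (h : ∀ x, p (f x)) (x : F.Obj X) :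
    Obj.All p (F.map f x) := by
  obtain ⟨i, ⟨φ⟩⟩ := x
  exact ⟨i, f ∘ φ, rfl, fun v => h _⟩

theorem DObj.all_dmap_of_forall {p : Y → Prop} {f : X → Y} (h : ∀ x, p (f x)) (c : F.DObj X) :
    DObj.All p (F.dmap f c) := by
  obtain ⟨i, ⟨q⟩⟩ := c
  exact ⟨i, ⟨q.1, f ∘ q.2⟩, rfl, fun v => h _⟩

theorem Obj.All.map {p : Y → Prop} {f : X → Y} {x : F.Obj X} (hx : Obj.All (fun a => p (f a)) x) :
    Obj.All p (F.map f x) := by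
  obtain ⟨i, φ, rfl, h⟩ := hx
  exact ⟨i, f ∘ φ, rfl, h⟩

theorem DObj.All.dmap {p : Y → Prop} {f : X → Y} {c : F.DObj X}
    (hc : DObj.All (fun a => p (f a)) c) : DObj.All p (F.dmap f c) := by
  obtain ⟨i, q, rfl, h⟩ := hc
  exact ⟨i, ⟨q.1, f ∘ q.2⟩, rfl, h⟩

theorem Obj.All.exists_map_eq {f : X → Y} {y : F.Obj Y} (hy : Obj.All (· ∈ Set.range f) y) :
    ∃ x, F.map f x = y := by
  obtain ⟨i, φ, rfl, h⟩ := hy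
  choose ψ hψ using h
  exact ⟨⟨i, Quotient.mk _ ψ⟩,
    congrArg (fun χ => (⟨i, Quotient.mk _ χ⟩ : F.Obj Y)) (funext hψ)⟩

theorem DObj.All.exists_dmap_eq {f : X → Y} {c : F.DObj Y} (hc : DObj.All (· ∈ Set.range f) c) :
    ∃ d, F.dmap f d = c := by
  obtain ⟨i, q, rfl, h⟩ := hc
  choose ψ hψ using h
  exact ⟨⟨i, Quotient.mk _ ⟨q.1, ψ⟩⟩,
    congrArg (fun χ => (⟨i, Quotient.mk _ ⟨q.1, χ⟩⟩ : F.DObj Y)) (funext hψ)⟩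

theorem fill_self {i : F.I} (p : F.Holed i X) (x : X) : F.fill p x p.1 = x := dif_pos rfl

theorem fill_of_ne {i : F.I} (p : F.Holed i X) (x : X) {v : F.U i} (h : v ≠ p.1) :
    F.fill p x v = p.2 ⟨v, h⟩ := dif_neg h

theorem fill_restrict {i : F.I} (φ : F.U i → X) (u : F.U i) :
    F.fill ⟨u, fun v => φ v.1⟩ (φ u) = φ := by
  ext v
  by_cases h : v = u
  · subst h
    exact fill_self _ _
  · exact fill_of_ne _ _ h

theorem Obj.mk_eq_mk {i : F.I} {φ ψ : F.U i → X}
    (h : (⟨i, Quotient.mk _ φ⟩ : F.Obj X) = ⟨i, Quotient.mk _ ψ⟩) :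
    ∃ σ ∈ F.H i, ψ = φ ∘ ⇑(σ⁻¹) :=
  Quotient.exact (eq_of_heq (Sigma.mk.inj h).2)

/-- If `e` factors through `f` on the values of `x` against arbitrary elements, then `F e` factors
through `F f` at `x`. -/
theorem map_eq_map_of_all {f : X → Y} {e : X → W} {x y : F.Obj X}
    (hx : Obj.All (fun a => ∀ b, f a = f b → e a = e b) x) (h : F.map f x = F.map f y) :
    F.map e x = F.map e y := by
  obtain ⟨i, φ, rfl, hφ⟩ := hx
  obtain ⟨j, ⟨ψ⟩⟩ := y
  obtain rfl : i = j := congrArg Sigma.fst h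
  obtain ⟨σ, hσ, hψ⟩ := Obj.mk_eq_mk h
  refine congrArg (Sigma.mk i) (Quotient.sound ⟨σ, hσ, ?_⟩)
  ext v
  exact (hφ (σ⁻¹ v) (ψ v) (congrFun hψ v).symm).symm

/-- The variant of `map_eq_map_of_all` for a filled context, where the filler is only compared with
the values of `y`. -/
theorem map_plug_eq_map_of_all {f : X → Y} {e : X → W} {c : F.DObj X} {a : X} {y : F.Obj X}
    (hc : DObj.All (fun b => ∀ b', f b = f b' → e b = e b') c)
    (hy : Obj.All (fun b' => f a = f b' → e a = e b') y)
    (h : F.map f (F.plug c a) = F.map f y) :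
    F.map e (F.plug c a) = F.map e y := by
  obtain ⟨i, p, rfl, hp⟩ := hc
  obtain ⟨j, ψ, rfl, hψ⟩ := hy
  obtain rfl : i = j := congrArg Sigma.fst h
  obtain ⟨σ, hσ, key⟩ := Obj.mk_eq_mk h
  refine congrArg (Sigma.mk i) (Quotient.sound ⟨σ, hσ, ?_⟩)
  ext v
  have hv : f (ψ v) = f (F.fill p a (σ⁻¹ v)) := congrFun key v
  change e (ψ v) = e (F.fill p a (σ⁻¹ v))
  by_cases hv₁ : σ⁻¹ v = p.1
  · rw [hv₁, fill_self] at hv ⊢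
    exact (hψ v hv.symm).symm
  · rw [fill_of_ne p _ hv₁] at hv ⊢
    exact (hp _ _ hv.symm).symm

/-- Two filled contexts that are identified by `F f` either have their holes matched, and then the
contexts and the fillers are identified separately, or the filler of each one is matched with a
value of the context of the other. -/
theorem dmap_eq_or_map_plug_eq {f : X → Y} {e : X → W} {c c' : F.DObj X} {a a' : X}
    (hc : DObj.All (fun b => ∀ b', f b = f b' → e b = e b') c)
    (hc' : DObj.All (fun b' => f a = f b' → e a = e b') c')
    (h : F.map f (F.plug c a) = F.map f (F.plug c' a')) :
    (F.dmap e c = F.dmap e c' ∧ f a = f a') ∨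
      F.map e (F.plug c a) = F.map e (F.plug c' a') := by
  obtain ⟨i, p, rfl, hp⟩ := hc
  obtain ⟨j, q, rfl, hq⟩ := hc'
  obtain rfl : i = j := congrArg Sigma.fst h
  obtain ⟨σ, hσ, hψ⟩ := Obj.mk_eq_mk h
  have key : ∀ v, f (F.fill q a' v) = f (F.fill p a (σ⁻¹ v)) := congrFun hψ
  -- The matching `σ` of the positions need not send the hole of `c` to the hole of `c'`.
  by_cases hu : σ p.1 = q.1
  · left
    constructor
    · refine congrArg (Sigma.mk i) (Quotient.sound ⟨σ, hσ, F.holed_ext hu.symm ?_⟩)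
      intro v hv hv'
      have hv₁ : σ⁻¹ v ≠ p.1 := fun h => hv' (Equiv.Perm.inv_eq_iff_eq.1 h)
      have := key v
      rw [fill_of_ne q _ hv, fill_of_ne p _ hv₁] at this
      exact (hp ⟨σ⁻¹ v, hv₁⟩ _ this.symm).symm
    · have := key q.1
      rw [fill_self, Equiv.Perm.inv_eq_iff_eq.2 hu.symm, fill_self] at this
      exact this.symm
  · right
    refine congrArg (Sigma.mk i) (Quotient.sound ⟨σ, hσ, ?_⟩)
    ext v
    change e (F.fill q a' v) = e (F.fill p a (σ⁻¹ v))
    have hv := key v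
    by_cases hv₁ : σ⁻¹ v = p.1
    · have hv₂ : v ≠ q.1 := fun h => hu (h ▸ (Equiv.Perm.inv_eq_iff_eq.1 hv₁).symm)
      rw [hv₁, fill_self, fill_of_ne q _ hv₂] at hv ⊢
      exact (hq _ hv.symm).symm
    · rw [fill_of_ne p _ hv₁] at hv ⊢
      exact (hp _ _ hv.symm).symm

/-! ### Algebra morphisms and terms -/

theorem Hom.map_str₀ {C D : Algebra F.sumFunctor} (m : C ⟶ D) (x : F.Obj C.a) :
    m.f (str₀ C x) = str₀ D (F.map (fun c => m.f c) x) :=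
  (types_congr_hom m.h (Sum.inl x : F.TObj C.a)).symm

theorem Hom.map_str₁ {C D : Algebra F.sumFunctor} (m : C ⟶ D) (s : F.GObj C.a) :
    m.f (str₁ C s) = str₁ D (F.gmap (fun c => m.f c) s) :=
  (types_congr_hom m.h (Sum.inr s : F.TObj C.a)).symm

theorem Hom.map_branch {C D : Algebra F.sumFunctor} (m : C ⟶ D) (s : F.GObj C.a) :
    F.map (fun c => m.f c) (branch C s) = branch D (F.gmap (fun c => m.f c) s) :=
  (F.map_plug _ _ _).trans (congrArg (F.plug _) (Hom.map_str₁ m (F.tail s)))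

/-- Structural induction on terms. -/
theorem terms_induction {p : F.terms.a → Prop}
    (h₀ : ∀ x : F.Obj F.terms.a, Obj.All p x → p (str₀ F.terms x))
    (h₁ : ∀ s : F.GObj F.terms.a, (∀ n, DObj.All p (s n)) → p (str₁ F.terms s)) (a) : p a := by
  refine QPF.Fix.ind (F := F.TObj) p ?_ a
  rintro _ ⟨x | s, rfl⟩
  · exact h₀ _ (Obj.all_map_of_forall (fun a => a.2) x)
  · exact h₁ _ fun n => DObj.all_dmap_of_forall (fun a => a.2) (s n)

theorem exists_eq_str (a : F.terms.a) :
    (∃ x, a = str₀ F.terms x) ∨ ∃ s, a = str₁ F.terms s :=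
  terms_induction (p := fun a => (∃ x, a = str₀ F.terms x) ∨ ∃ s, a = str₁ F.terms s)
    (fun x _ => .inl ⟨x, rfl⟩) (fun s _ => .inr ⟨s, rfl⟩) a

theorem operational_str₀ (x : F.Obj F.terms.a) :
    F.operational (str₀ F.terms x) = F.beta₀ (F.map F.operational x) := by
  rw [← F.denotational_eq_operational, Hom.map_str₀, funext F.denotational_eq_operational]
  rfl

theorem operational_str₁ (s : F.GObj F.terms.a) :
    F.operational (str₁ F.terms s) = F.beta₁ (F.gmap F.operational s) := by
  rw [← F.denotational_eq_operational, Hom.map_str₁, funext F.denotational_eq_operational]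
  rfl

theorem behaviours_operational_str₀ (x : F.Obj F.terms.a) :
    F.behaviours.str (F.operational (str₀ F.terms x)) = F.map F.operational x := by
  rw [operational_str₀, behaviours_beta₀]

theorem behaviours_operational_str₁ (s : F.GObj F.terms.a) :
    F.behaviours.str (F.operational (str₁ F.terms s)) =
      F.map F.operational (branch F.terms s) := by
  rw [operational_str₁, behaviours_beta₁, branch, map_plug, operational_str₁]
  rfl

/-! ### Completeness of the coherence equation -/

variable {C : Algebra F.sumFunctor}

/-- Into a coherent algebra, a stream term is evaluated like its unfolding. -/
theorem map_str₁_eq_branch (hC : Coherent C) (e : F.terms ⟶ C) (s : F.GObj F.terms.a) :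
    e.f (str₁ F.terms s) = str₀ C (F.map (fun a => e.f a) (branch F.terms s)) := by
  rw [Hom.map_str₁, hC, Hom.map_branch]

/-- Every term has an unfolding to an `F`-structure over terms that is correct both for its
behaviour and for its value in a coherent algebra. -/
theorem exists_unfolding (hC : Coherent C) (e : F.terms ⟶ C) (a : F.terms.a) :
    ∃ y : F.Obj F.terms.a, F.behaviours.str (F.operational a) = F.map F.operational y ∧
      e.f a = str₀ C (F.map (fun a => e.f a) y) := by
  rcases exists_eq_str a with ⟨x, rfl⟩ | ⟨s, rfl⟩
  · exact ⟨x, behaviours_operational_str₀ x, Hom.map_str₀ e x⟩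
  · exact ⟨branch F.terms s, behaviours_operational_str₁ s, map_str₁_eq_branch hC e s⟩

theorem map_str₁_eq_of_dmap_eq (e : F.terms ⟶ C) {s s' : F.GObj F.terms.a}
    (h : ∀ n, F.dmap (fun a => e.f a) (s n) = F.dmap (fun a => e.f a) (s' n)) :
    e.f (str₁ F.terms s) = e.f (str₁ F.terms s') := by
  rw [Hom.map_str₁, Hom.map_str₁]
  exact congrArg (str₁ C) (funext h)

/-- A term `a` all of whose semantic equalities with other terms hold in `C` as well. -/
def Resolved (e : F.terms ⟶ C) (a : F.terms.a) : Prop :=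
  ∀ b, F.operational a = F.operational b → e.f a = e.f b

/-- A term `b` all of whose semantic equalities with stream terms over resolved terms hold in `C`
as well. -/
def StreamResolved (e : F.terms ⟶ C) (b : F.terms.a) : Prop :=
  ∀ s : F.GObj F.terms.a, (∀ n, DObj.All (Resolved e) (s n)) →
    F.operational (str₁ F.terms s) = F.operational b → e.f (str₁ F.terms s) = e.f b

/-- One step of the comparison of two stream terms: unless the terms are identified in `C`, their
holes are matched, their heads are identified, and the comparison goes on with the tails. -/
theorem map_head_eq_and_tail (hC : Coherent C) (e : F.terms ⟶ C) {s s' : F.GObj F.terms.a}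
    (hs : ∀ n, DObj.All (Resolved e) (s n)) (hs' : ∀ n, DObj.All (StreamResolved e) (s' n))
    (h : F.operational (str₁ F.terms s) = F.operational (str₁ F.terms s'))
    (hne : e.f (str₁ F.terms s) ≠ e.f (str₁ F.terms s')) :
    F.dmap (fun a => e.f a) (s 0) = F.dmap (fun a => e.f a) (s' 0) ∧
      F.operational (str₁ F.terms (F.tail s)) = F.operational (str₁ F.terms (F.tail s')) ∧
      e.f (str₁ F.terms (F.tail s)) ≠ e.f (str₁ F.terms (F.tail s')) := by
  rw [map_str₁_eq_branch hC, map_str₁_eq_branch hC] at hne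
  have hbr : F.map F.operational (branch F.terms s) =
      F.map F.operational (branch F.terms s') := by
    rw [← behaviours_operational_str₁, ← behaviours_operational_str₁, h]
  obtain ⟨h₁, h₂⟩ := (dmap_eq_or_map_plug_eq (e := fun a => e.f a) (hs 0)
    ((hs' 0).mono fun b hb => hb (F.tail s) fun n => hs (n + 1)) hbr).resolve_right
      fun h₁ => hne (congrArg (str₀ C) h₁)
  refine ⟨h₁, h₂, fun h₃ => hne (congrArg (str₀ C) ?_)⟩
  rw [branch, branch, map_plug, map_plug, h₃]
  exact congrArg (fun c => F.plug c _) h₁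

/-- Two stream terms with the same behaviour are identified in every coherent algebra, provided that
their components are. Either the holes are matched forever, and the streams are identified
componentwise, or the matching breaks at some depth, where each of the two remaining stream terms is
compared with a component of the other. -/
theorem map_str₁_eq_of_operational_eq (hC : Coherent C) (e : F.terms ⟶ C)
    {s s' : F.GObj F.terms.a}
    (hs : ∀ n, DObj.All (Resolved e) (s n)) (hs' : ∀ n, DObj.All (StreamResolved e) (s' n))
    (h : F.operational (str₁ F.terms s) = F.operational (str₁ F.terms s')) :
    e.f (str₁ F.terms s) = e.f (str₁ F.terms s') := by
  by_contra hne
  refine hne (map_str₁_eq_of_dmap_eq e fun n => ?_)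
  induction n generalizing s s' with
  | zero => exact (map_head_eq_and_tail hC e hs hs' h hne).1
  | succ n ih =>
    obtain ⟨-, h', hne'⟩ := map_head_eq_and_tail hC e hs hs' h hne
    exact ih (fun n => hs (n + 1)) (fun n => hs' (n + 1)) h' hne'

/-- Terms with the same behaviour are identified in every coherent algebra: the coherence equation
is complete for equality of behaviours. The induction on `a` is over all `b` at once. If `a` is a
stream term, then an inner induction on `b` considers all stream terms over resolved terms at
once, so that it also applies to the tails of `a`. -/
theorem map_eq_of_operational_eq (hC : Coherent C) (e : F.terms ⟶ C) (a b : F.terms.a)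
    (h : F.operational a = F.operational b) : e.f a = e.f b := by
  refine terms_induction (p := Resolved e) ?_ ?_ a b h
  · intro x hx b hb
    obtain ⟨y, hy, hy'⟩ := exists_unfolding hC e b
    rw [hy', Hom.map_str₀]
    refine congrArg (str₀ C) (map_eq_map_of_all hx ?_)
    rw [← hy, ← hb, behaviours_operational_str₀]
  · intro s hs b hb
    refine terms_induction (p := StreamResolved e) ?_ ?_ b s hs hb
    · intro x hx s hs h
      have hbr : F.map F.operational (branch F.terms s) = F.map F.operational x := by
        rw [← behaviours_operational_str₁, h, behaviours_operational_str₀]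
      rw [map_str₁_eq_branch hC, Hom.map_str₀]
      refine congrArg (str₀ C) (map_plug_eq_map_of_all (hs 0)
        (hx.mono fun b hb => hb (F.tail s) fun n => hs (n + 1)) hbr)
    · intro s' hs' s hs h
      exact map_str₁_eq_of_operational_eq hC e hs hs' h

/-! ### The initial coherent algebra -/

theorem coherent_behavioursAlgebra : Coherent F.behavioursAlgebra := by
  intro s
  exact (F.beta₀_behaviours (F.beta₁ s)).symm.trans (congrArg F.beta₀ (F.behaviours_beta₁ s))

theorem operational_str (x : F.TObj F.terms.a) : F.operational (F.terms.str x) =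
    F.behavioursAlgebra.str (F.tmap F.operational x) := by
  rcases x with x | s
  · exact operational_str₀ x
  · exact operational_str₁ s

/-- The semantics as an algebra morphism onto the subalgebra of constructible behaviours. -/
noncomputable def toConstructible : F.terms ⟶ F.constructibleAlgebra where
  f := ↾fun a => (⟨F.operational a, a, rfl⟩ : F.constructible)
  h := by
    ext x
    exact Subtype.ext (Eq.trans (congrArg (fun y => F.behavioursAlgebra.str y)
      (F.tmap_comp _ _ _).symm) (operational_str x).symm)

theorem toConstructible_surjective :
    Function.Surjective (fun a => (toConstructible (F := F)).f a) := by
  rintro ⟨_, a, rfl⟩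
  exact ⟨a, rfl⟩

theorem coherent_subalgebra (hC : Coherent C) (S : Set C.a) (hS : IsClosedUnder C S) :
    Coherent (subalgebra C S hS) := by
  intro s
  refine Subtype.ext ?_
  refine (hC _).trans (congrArg (str₀ C) ?_)
  exact (F.map_plug Subtype.val (F.head s) (str₁ (subalgebra C S hS) (F.tail s))).symm

/-- An algebra morphism descends along a surjective one whose kernel it respects. -/
theorem Hom.exists_desc {A B C : Algebra F.sumFunctor} (p : A ⟶ B) (e : A ⟶ C)
    (hp : Function.Surjective fun a => p.f a) (he : ∀ a b, p.f a = p.f b → e.f a = e.f b) :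
    ∃ m : B ⟶ C, ∀ a, m.f (p.f a) = e.f a := by
  choose g hg using hp
  have hge : ∀ a, e.f (g (p.f a)) = e.f a := fun a => he _ _ (hg _)
  refine ⟨{ f := ↾fun b => e.f (g b), h := ?_ }, hge⟩
  ext x
  obtain ⟨y, rfl⟩ : ∃ y, F.tmap (fun a => p.f a) y = x := by
    refine ⟨F.tmap g x, (F.tmap_comp _ _ _).symm.trans (Eq.trans ?_ (F.tmap_id x))⟩
    exact congrArg (fun f => F.tmap f x) (funext hg)
  have h₁ : B.str (F.tmap (fun a => p.f a) y) = p.f (A.str y) := types_congr_hom p.h y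
  have h₂ : C.str (F.tmap (fun a => e.f a) y) = e.f (A.str y) := types_congr_hom e.h y
  calc C.str (F.tmap (fun b => e.f (g b)) (F.tmap (fun a => p.f a) y))
      = C.str (F.tmap (fun a => e.f (g (p.f a))) y) :=
        congrArg (fun z => C.str z) (F.tmap_comp _ _ _).symm
    _ = C.str (F.tmap (fun a => e.f a) y) :=
        congrArg (fun f => C.str (F.tmap f y)) (funext hge)
    _ = e.f (g (p.f (A.str y))) := h₂.trans (hge _).symm
    _ = e.f (g (B.str (F.tmap (fun a => p.f a) y))) := congrArg (fun b => e.f (g b)) h₁.symm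

theorem coherent_quotientTerms : Coherent F.quotientTerms := by
  intro s
  obtain ⟨t, rfl⟩ : ∃ t, F.gmap (fun a => F.quotientTermsMap.f a) t = s := by
    refine ⟨F.gmap Quotient.out s, funext fun n => ?_⟩
    refine (F.dmap_comp _ _ _).symm.trans (Eq.trans ?_ (F.dmap_id (s n)))
    exact congrArg (fun f => F.dmap f (s n)) (funext Quotient.out_eq)
  rw [← Hom.map_branch, ← Hom.map_str₁, ← Hom.map_str₀]
  exact Quotient.sound fun r hr => hr.2 t

/-- Soundness: the coherence equation only identifies terms with the same behaviour. -/
theorem operational_eq_of_coherenceCongruence {a b : F.terms.a}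
    (h : coherenceCongruence F.terms a b) : F.operational a = F.operational b := by
  refine h (Setoid.ker F.operational) ⟨fun x y hxy => ?_, fun s => ?_⟩
  · change F.operational _ = F.operational _
    have e : F.operational = Quotient.lift (s := Setoid.ker F.operational) F.operational
        (fun _ _ h => h) ∘ Quotient.mk _ := rfl
    have h : F.tmap F.operational x = F.tmap F.operational y := by
      rw [e, F.tmap_comp, F.tmap_comp, hxy]
    exact (operational_str x).trans
      ((congrArg (fun y => F.behavioursAlgebra.str y) h).trans (operational_str y).symm)
  · change F.operational _ = F.operational _
    rw [operational_str₀, ← behaviours_operational_str₁, beta₀_behaviours]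

theorem nonempty_constructibleAlgebra_iso_quotientTerms :
    Nonempty (F.constructibleAlgebra ≅ F.quotientTerms) := by
  obtain ⟨m, hm⟩ := Hom.exists_desc toConstructible F.quotientTermsMap
    toConstructible_surjective fun a b h =>
      map_eq_of_operational_eq coherent_quotientTerms _ _ _ (congrArg Subtype.val h)
  have : IsIso m.f := by
    rw [isIso_iff_bijective]
    constructor
    · intro z w h
      obtain ⟨a, rfl⟩ := toConstructible_surjective z
      obtain ⟨b, rfl⟩ := toConstructible_surjective w
      refine Subtype.ext (operational_eq_of_coherenceCongruence (Quotient.exact ?_))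
      exact (hm a).symm.trans (h.trans (hm b))
    · intro q
      obtain ⟨a, rfl⟩ := Quotient.exists_rep q
      exact ⟨_, hm a⟩
  have := Algebra.iso_of_iso m
  exact ⟨asIso m⟩

theorem nonempty_unique_constructibleAlgebra_hom (hC : Coherent C) :
    Nonempty (Unique (F.constructibleAlgebra ⟶ C)) := by
  obtain ⟨m, hm⟩ := Hom.exists_desc toConstructible (F.termsIsInitial.to C)
    toConstructible_surjective fun a b h =>
      map_eq_of_operational_eq hC _ _ _ (congrArg Subtype.val h)
  refine ⟨⟨⟨m⟩, fun m' => ?_⟩⟩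
  ext z
  obtain ⟨a, rfl⟩ := toConstructible_surjective z
  refine Eq.trans ?_ (hm a).symm
  exact types_congr_hom
    (congrArg Algebra.Hom.f (F.termsIsInitial.hom_ext (toConstructible ≫ m') _)) a

theorem nonempty_isInitial_constructible
    (h : Coherent (subalgebra F.behavioursAlgebra F.constructible F.constructible_isClosedUnder)) :
    Nonempty (Limits.IsInitial (⟨_, h⟩ : CoherentAlgebra F)) := by
  have u := fun C : CoherentAlgebra F =>
    (nonempty_unique_constructibleAlgebra_hom (C := C.obj) C.property).some
  exact ⟨Limits.IsInitial.ofUniqueHom (fun C => ObjectProperty.homMk (u C).default)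
    fun C m' => ObjectProperty.hom_ext _ ((u C).uniq m'.hom)⟩

/-! ### Successors and paths -/

theorem mem_successors_iff {T : Coalgebra F.functor} {t : T.V} {i : F.I} {φ : F.U i → T.V}
    (h : T.str t = (⟨i, Quotient.mk _ φ⟩ : F.Obj T.V)) {p : T.V × ℕ} :
    p ∈ successors T t ↔ p.2 < Nat.card {u : F.U i // φ u = p.1} := by
  change p.2 < multiplicity (F := F) (T.str t) p.1 ↔ _
  rw [h]
  rfl

/-- Every element of `F X` has a representative. -/
theorem exists_mk_eq (x : F.Obj X) : ∃ (i : F.I) (φ : F.U i → X), x = ⟨i, Quotient.mk _ φ⟩ := by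
  obtain ⟨i, ⟨φ⟩⟩ := x
  exact ⟨i, φ, rfl⟩

theorem zero_mem_successors {T : Coalgebra F.functor} {t : T.V} {i : F.I} {φ : F.U i → T.V}
    (h : T.str t = (⟨i, Quotient.mk _ φ⟩ : F.Obj T.V)) (u : F.U i) :
    (φ u, 0) ∈ successors T t := by
  have := F.finite_U i
  rw [mem_successors_iff h]
  exact Nat.card_pos_iff.2 ⟨⟨⟨u, rfl⟩⟩, inferInstance⟩

theorem exists_eq_of_mem_successors {T : Coalgebra F.functor} {t : T.V} {i : F.I}
    {φ : F.U i → T.V} (h : T.str t = (⟨i, Quotient.mk _ φ⟩ : F.Obj T.V)) {p : T.V × ℕ}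
    (hp : p ∈ successors T t) : ∃ u, φ u = p.1 := by
  rw [mem_successors_iff h] at hp
  obtain ⟨u, hu⟩ := (Nat.card_pos_iff.1 (Nat.zero_lt_of_lt hp)).1
  exact ⟨u, hu⟩

theorem finite_successors (T : Coalgebra F.functor) (t : T.V) : (successors T t).Finite := by
  obtain ⟨i, φ, h⟩ := exists_mk_eq (F := F) (T.str t)
  have := F.finite_U i
  refine ((Set.finite_range φ).prod (Set.finite_Iio (Nat.card (F.U i)))).subset fun p hp => ?_
  refine ⟨exists_eq_of_mem_successors h hp, ?_⟩
  rw [mem_successors_iff h] at hp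
  exact hp.trans_le (Nat.card_le_card_of_injective _ Subtype.val_injective)

/-- The path obtained by prepending a state and a number. -/
def consPath {V : Type u} (t : V) (k : ℕ) (p : (ℕ → V) × (ℕ → ℕ)) : (ℕ → V) × (ℕ → ℕ) :=
  (fun n => n.casesOn t p.1, fun n => n.casesOn k p.2)

/-- The path without its first state and its first number. -/
def tailPath {V : Type u} (p : (ℕ → V) × (ℕ → ℕ)) : (ℕ → V) × (ℕ → ℕ) :=
  (fun n => p.1 (n + 1), fun n => p.2 (n + 1))

theorem consPath_tailPath {V : Type u} (p : (ℕ → V) × (ℕ → ℕ)) :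
    consPath (p.1 0) (p.2 0) (tailPath p) = p := by
  refine Prod.ext (funext fun n => ?_) (funext fun n => ?_) <;> cases n <;> rfl

theorem tailPath_mem {T : Coalgebra F.functor} {t : T.V} {p : (ℕ → T.V) × (ℕ → ℕ)}
    (hp : p ∈ infinitePaths T t) : tailPath p ∈ infinitePaths T (p.1 1) :=
  ⟨rfl, fun n => hp.2 (n + 1)⟩

theorem head_mem_successors {T : Coalgebra F.functor} {t : T.V} {p : (ℕ → T.V) × (ℕ → ℕ)}
    (hp : p ∈ infinitePaths T t) : (p.1 1, p.2 0) ∈ successors T t :=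
  hp.1 ▸ hp.2 0

/-- Countability of a set of paths can be checked on the sets of tails, as states have only finitely
many successors. -/
theorem countable_paths_of_tails {T : Coalgebra F.functor} {t : T.V}
    {S : Set ((ℕ → T.V) × (ℕ → ℕ))} (hS : S ⊆ infinitePaths T t)
    (P : T.V × ℕ → Set ((ℕ → T.V) × (ℕ → ℕ))) (hP : ∀ q ∈ successors T t, (P q).Countable)
    (h : ∀ p ∈ S, tailPath p ∈ P (p.1 1, p.2 0)) : S.Countable := by
  refine ((finite_successors T t).countable.biUnion fun q hq =>
    (hP q hq).image (consPath t q.2)).mono fun p hp => ?_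
  refine Set.mem_biUnion (head_mem_successors (hS hp)) ⟨_, h p hp, ?_⟩
  rw [← (hS hp).1]
  exact consPath_tailPath p

theorem thin_of_successors {T : Coalgebra F.functor} {t : T.V}
    (h : ∀ q ∈ successors T t, Thin T q.1) : Thin T t :=
  countable_paths_of_tails subset_rfl (fun q => infinitePaths T q.1) h fun _ hp => tailPath_mem hp

/-- Only countably many paths visit a thin state. -/
theorem countable_paths_visiting_thin (T : Coalgebra F.functor) (t : T.V) :
    {p ∈ infinitePaths T t | ∃ n, Thin T (p.1 n)}.Countable := by
  have key : ∀ n (t : T.V), {p ∈ infinitePaths T t | Thin T (p.1 n)}.Countable := by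
    intro n
    induction n with
    | zero =>
      intro t
      by_cases ht : Thin T t
      · exact ht.mono fun p hp => hp.1
      · refine Set.countable_empty.mono ?_
        rintro p ⟨hp, h⟩
        exact ht (hp.1 ▸ h)
    | succ n ih =>
      intro t
      exact countable_paths_of_tails (fun p hp => hp.1) (fun q => _) (fun q _ => ih q.1)
        fun p hp => ⟨tailPath_mem hp.1, hp.2⟩
  refine (Set.countable_iUnion fun n => key n t).mono ?_
  rintro p ⟨hp, n, hn⟩
  exact Set.mem_iUnion.2 ⟨n, hp, hn⟩

/-! ### Constructible behaviours are thin -/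

theorem thin_beta₀ {x : F.Obj F.behaviours.V} (hx : Obj.All (Thin F.behaviours) x) :
    Thin F.behaviours (F.beta₀ x) := by
  obtain ⟨i, φ, rfl, hφ⟩ := hx
  refine thin_of_successors fun q hq => ?_
  obtain ⟨u, hu⟩ := exists_eq_of_mem_successors (F.behaviours_beta₀ _) hq
  exact hu ▸ hφ u

/-- If the contexts of `s` only contain thin behaviours, then a successor of `β₁ s` that is not thin
fills the hole of the head, and it has multiplicity one. -/
theorem eq_of_mem_successors_beta₁ {s : F.GObj F.behaviours.V}
    (hs : ∀ n, DObj.All (Thin F.behaviours) (s n)) {q : F.behaviours.V × ℕ}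
    (hq : q ∈ successors F.behaviours (F.beta₁ s)) (hn : ¬ Thin F.behaviours q.1) :
    q = (F.beta₁ (F.tail s), 0) := by
  obtain ⟨i, c, hc, hφ⟩ := hs 0
  have hstr : F.behaviours.str (F.beta₁ s) =
      (⟨i, Quotient.mk _ (F.fill c (F.beta₁ (F.tail s)))⟩ : F.Obj F.behaviours.V) :=
    (F.behaviours_beta₁ s).trans (congrArg (fun d => F.plug d _) hc)
  have hole : ∀ u, F.fill c (F.beta₁ (F.tail s)) u = q.1 → u = c.1 := by
    intro u hu
    by_contra hne
    rw [fill_of_ne _ _ hne] at hu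
    exact hn (hu ▸ hφ _)
  obtain ⟨u, hu⟩ := exists_eq_of_mem_successors hstr hq
  refine Prod.ext ?_ ?_
  · rw [← hu, hole u hu, fill_self]
  · rw [mem_successors_iff hstr] at hq
    have : Subsingleton {u // F.fill c (F.beta₁ (F.tail s)) u = q.1} :=
      ⟨fun a b => Subtype.ext ((hole _ a.2).trans (hole _ b.2).symm)⟩
    exact Nat.lt_one_iff.1 (hq.trans_le (Finite.card_le_one_iff_subsingleton.2 this))

/-- Apart from the paths that visit a thin behaviour, `β₁ s` has at most the path that plugs in the
tails forever. -/
theorem thin_beta₁ {s : F.GObj F.behaviours.V}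
    (hs : ∀ n, DObj.All (Thin F.behaviours) (s n)) : Thin F.behaviours (F.beta₁ s) := by
  have key : ∀ n (s : F.GObj F.behaviours.V), (∀ n, DObj.All (Thin F.behaviours) (s n)) →
      ∀ p ∈ infinitePaths F.behaviours (F.beta₁ s), (∀ n, ¬ Thin F.behaviours (p.1 n)) →
        p.1 (n + 1) = F.beta₁ (F.tail^[n + 1] s) ∧ p.2 n = 0 := by
    intro n
    induction n with
    | zero =>
      intro s hs p hp hn
      exact Prod.ext_iff.1 (eq_of_mem_successors_beta₁ hs (head_mem_successors hp) (hn 1))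
    | succ n ih =>
      intro s hs p hp hn
      have h : p.1 1 = F.beta₁ (F.tail s) :=
        congrArg Prod.fst (eq_of_mem_successors_beta₁ hs (head_mem_successors hp) (hn 1))
      exact ih (F.tail s) (fun n => hs (n + 1)) (tailPath p) (h ▸ tailPath_mem hp)
        fun n => hn (n + 1)
  refine ((countable_paths_visiting_thin F.behaviours (F.beta₁ s)).union
    (Set.countable_singleton (fun n => F.beta₁ (F.tail^[n] s), fun _ => 0))).mono fun p hp => ?_
  by_cases h : ∃ n, Thin F.behaviours (p.1 n)
  · exact Or.inl ⟨hp, h⟩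
  · have h' := fun n => key n s hs p hp (not_exists.1 h)
    refine Or.inr (Prod.ext (funext fun n => ?_) (funext fun n => (h' n).2))
    cases n with
    | zero => exact hp.1
    | succ n => exact (h' n).1

theorem thin_operational (a : F.terms.a) : Thin F.behaviours (F.operational a) := by
  refine terms_induction (p := fun a => Thin F.behaviours (F.operational a)) ?_ ?_ a
  · intro x hx
    rw [operational_str₀]
    exact thin_beta₀ hx.map
  · intro s hs
    rw [operational_str₁]
    exact thin_beta₁ fun n => (hs n).dmap

/-! ### Binary branching yields uncountably many paths -/

section Branching

variable {V : Type*} (Split : V → Prop) (σ : V → Bool → V × ℕ)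

open Classical in
/-- The transition taken from a state under the control of a bit stream: at a splitting state the
first bit decides. -/
noncomputable def steer (x : V × (ℕ → Bool)) : V × ℕ :=
  if Split x.1 then σ x.1 (x.2 0) else σ x.1 false

open Classical in
/-- The bits that remain after the transition: one is consumed at a splitting state only. -/
noncomputable def restBits (x : V × (ℕ → Bool)) : ℕ → Bool :=
  if Split x.1 then fun n => x.2 (n + 1) else x.2

/-- The transition of states with their bit streams. -/
noncomputable def steerNext (x : V × (ℕ → Bool)) : V × (ℕ → Bool) :=
  ((steer Split σ x).1, restBits Split x)

/-- The sequence of the transitions under the control of a bit stream. -/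
noncomputable def steerTrace (x : V × (ℕ → Bool)) (n : ℕ) : V × ℕ :=
  steer Split σ ((steerNext Split σ)^[n] x)

/-- The path under the control of a bit stream. -/
noncomputable def steerPath (x : V × (ℕ → Bool)) : (ℕ → V) × (ℕ → ℕ) :=
  (fun n => ((steerNext Split σ)^[n] x).1, fun n => (steerTrace Split σ x n).2)

variable {Split σ}

theorem steerPath_fst_succ (x : V × (ℕ → Bool)) (n : ℕ) :
    (steerPath Split σ x).1 (n + 1) = (steerTrace Split σ x n).1 :=
  congrArg Prod.fst (Function.iterate_succ_apply' _ n x)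

theorem steerTrace_eq_of_steerPath_eq {x y : V × (ℕ → Bool)}
    (h : steerPath Split σ x = steerPath Split σ y) : steerTrace Split σ x = steerTrace Split σ y :=
  funext fun n => Prod.ext
    (by rw [← steerPath_fst_succ, h, steerPath_fst_succ]) (congrFun (congrArg Prod.snd h) n)

variable {N : V → Prop}

theorem steerNext_fst (hN : ∀ z, N z → ∀ b, N (σ z b).1)
    {x : V × (ℕ → Bool)} (hx : N x.1) : N (steerNext Split σ x).1 := by
  unfold steerNext steer
  split_ifs
  · exact hN _ hx _
  · exact hN _ hx _

/-- The trace up to the first splitting state determines the first bit, and the rest of the trace is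
controlled by the rest of the bits. -/
theorem apply_zero_eq_of_steerTrace_eq (hN : ∀ z, N z → ∀ b, N (σ z b).1)
    (hσ : ∀ z, N z → Split z → σ z false ≠ σ z true) (n : ℕ) (z : V) (hz : N z)
    (hs : Split ((fun z => (σ z false).1)^[n] z)) (b b' : ℕ → Bool)
    (h : steerTrace Split σ (z, b) = steerTrace Split σ (z, b')) :
    b 0 = b' 0 ∧ ∃ w, N w ∧ steerTrace Split σ (w, fun n => b (n + 1)) =
      steerTrace Split σ (w, fun n => b' (n + 1)) := by
  have hshift : ∀ k, steerTrace Split σ (steerNext Split σ (z, b)) k =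
      steerTrace Split σ (steerNext Split σ (z, b')) k := fun k => congrFun h (k + 1)
  have h₀ : steer Split σ (z, b) = steer Split σ (z, b') := congrFun h 0
  by_cases hz' : Split z
  · have hb : b 0 = b' 0 := by
      simp only [steer, if_pos hz'] at h₀
      have := hσ z hz hz'
      cases hb : b 0 <;> cases hb' : b' 0 <;> simp_all
    have e : ∀ c : ℕ → Bool, steerNext Split σ (z, c) = ((σ z (c 0)).1, fun n => c (n + 1)) :=
      fun c => by simp only [steerNext, steer, restBits, if_pos hz']
    refine ⟨hb, (σ z (b 0)).1, hN z hz _, funext fun k => ?_⟩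
    have := hshift k
    rwa [e, e, ← hb] at this
  · have e : ∀ c : ℕ → Bool, steerNext Split σ (z, c) = ((σ z false).1, c) :=
      fun c => by simp only [steerNext, steer, restBits, if_neg hz']
    cases n with
    | zero => exact absurd hs hz'
    | succ n =>
      refine apply_zero_eq_of_steerTrace_eq hN hσ n (σ z false).1 (hN z hz _) hs b b'
        (funext fun k => ?_)
      have := hshift k
      rwa [e, e] at this

theorem steerPath_injective (hN : ∀ z, N z → ∀ b, N (σ z b).1)
    (hσ : ∀ z, N z → Split z → σ z false ≠ σ z true)
    (hsplit : ∀ z, N z → ∃ n, Split ((fun z => (σ z false).1)^[n] z))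
    {z : V} (hz : N z) :
    Function.Injective fun b => steerPath Split σ (z, b) := by
  have key : ∀ n z, N z → ∀ b b' : ℕ → Bool,
      steerTrace Split σ (z, b) = steerTrace Split σ (z, b') → b n = b' n := by
    intro n
    induction n with
    | zero =>
      intro z hz b b' h
      obtain ⟨m, hm⟩ := hsplit z hz
      exact (apply_zero_eq_of_steerTrace_eq hN hσ m z hz hm b b' h).1
    | succ n ih =>
      intro z hz b b' h
      obtain ⟨m, hm⟩ := hsplit z hz
      obtain ⟨-, w, hw, hw'⟩ := apply_zero_eq_of_steerTrace_eq hN hσ m z hz hm b b' h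
      exact ih w hw _ _ hw'
  exact fun b b' h => funext fun n => key n z hz b b' (steerTrace_eq_of_steerPath_eq h)

theorem uncountable_bitStreams : ¬ Countable (ℕ → Bool) := by
  intro h
  obtain ⟨f, hf⟩ := exists_surjective_nat (ℕ → Bool)
  obtain ⟨n, hn⟩ := hf fun n => !(f n n)
  exact Bool.eq_not_self _ |>.mp (congrFun hn n)

/-- A state has uncountably many paths if it satisfies an invariant `N` such that every state in
`N` can be continued in `N` until a splitting state is met, which has two distinct transitions
into `N`. -/
theorem not_thin_of_steer {T : Coalgebra F.functor} {Split N : T.V → Prop}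
    {σ : T.V → Bool → T.V × ℕ} (hN : ∀ z, N z → ∀ b, N (σ z b).1)
    (hmem : ∀ z, N z → ∀ b, σ z b ∈ successors T z)
    (hσ : ∀ z, N z → Split z → σ z false ≠ σ z true)
    (hsplit : ∀ z, N z → ∃ n, Split ((fun z => (σ z false).1)^[n] z)) {z : T.V} (hz : N z) :
    ¬ Thin T z := by
  intro h
  have hx : ∀ b n, N ((steerNext Split σ)^[n] (z, b)).1 := by
    intro b n
    induction n with
    | zero => exact hz
    | succ n ih =>
      rw [Function.iterate_succ_apply']
      exact steerNext_fst hN ih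
  have hpath : ∀ b, steerPath Split σ (z, b) ∈ infinitePaths T z := by
    refine fun b => ⟨rfl, fun n => ?_⟩
    rw [steerPath_fst_succ]
    change steer Split σ _ ∈ successors T ((steerNext Split σ)^[n] (z, b)).1
    unfold steer
    split_ifs
    · exact hmem _ (hx b n) _
    · exact hmem _ (hx b n) _
  have : Countable (infinitePaths T z) := h
  refine uncountable_bitStreams (Function.Injective.countable
    (f := fun b => (⟨_, hpath b⟩ : infinitePaths T z)) fun b b' hb => ?_)
  exact steerPath_injective hN hσ hsplit hz (congrArg Subtype.val hb)

end Branching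

/-! ### Thin behaviours are constructible -/

/-- Coinduction: a sequence of behaviours, each of which plugs its successor into a context, is
given by `β₁`. -/
theorem eq_beta₁_of_forall_plug {z : ℕ → F.behaviours.V} {s : F.GObj F.behaviours.V}
    (h : ∀ n, F.behaviours.str (z n) = F.plug (s n) (z (n + 1))) : z 0 = F.beta₁ s := by
  refine QPF.Cofix.bisim_rel (F := F.Obj) (fun a b => ∃ (z : ℕ → F.behaviours.V)
    (s : F.GObj F.behaviours.V), a = z 0 ∧ b = F.beta₁ s ∧
      ∀ n, F.behaviours.str (z n) = F.plug (s n) (z (n + 1))) ?_ _ _ ⟨z, s, rfl, rfl, h⟩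
  rintro _ _ ⟨z, s, rfl, rfl, h⟩
  refine (congrArg (F.map _) (h 0)).trans
    (Eq.trans ?_ (congrArg (F.map _) (F.behaviours_beta₁ s)).symm)
  refine (F.map_plug _ _ _).trans (Eq.trans (congrArg (F.plug _) ?_) (F.map_plug _ _ _).symm)
  exact Quot.sound ⟨fun n => z (n + 1), F.tail s, rfl, rfl, fun n => h (n + 1)⟩

theorem beta₀_mem_constructible {x : F.Obj F.behaviours.V}
    (hx : Obj.All (· ∈ F.constructible) x) : F.beta₀ x ∈ F.constructible := by
  obtain ⟨y, rfl⟩ := hx.exists_map_eq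
  exact ⟨_, operational_str₀ y⟩

theorem beta₁_mem_constructible {s : F.GObj F.behaviours.V}
    (hs : ∀ n, DObj.All (· ∈ F.constructible) (s n)) : F.beta₁ s ∈ F.constructible := by
  choose t ht using fun n => (hs n).exists_dmap_eq
  exact ⟨_, (operational_str₁ t).trans (congrArg F.beta₁ (funext ht))⟩

/-- A behaviour with two successors, counted with multiplicity, that are not constructible. -/
def Splits (z : F.behaviours.V) : Prop :=
  ∃ p ∈ successors F.behaviours z, ∃ q ∈ successors F.behaviours z,
    p ≠ q ∧ p.1 ∉ F.constructible ∧ q.1 ∉ F.constructible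

theorem exists_successor_not_constructible {z : F.behaviours.V} (hz : z ∉ F.constructible) :
    ∃ p ∈ successors F.behaviours z, p.1 ∉ F.constructible := by
  by_contra! h
  obtain ⟨i, φ, hφ⟩ := exists_mk_eq (F := F) (F.behaviours.str z)
  refine hz ?_
  rw [← F.beta₀_behaviours z]
  exact beta₀_mem_constructible ⟨i, φ, hφ, fun u => h _ (zero_mem_successors hφ u)⟩

/-- If only one successor of `z`, counted with multiplicity, is not constructible, then `z` plugs it
into a context of constructible behaviours. -/
theorem exists_plug_of_not_splits {z : F.behaviours.V} (hz : ¬ Splits z)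
    {p : F.behaviours.V × ℕ} (hp : p ∈ successors F.behaviours z) (hpn : p.1 ∉ F.constructible) :
    ∃ c : F.DObj F.behaviours.V, DObj.All (· ∈ F.constructible) c ∧
      F.behaviours.str z = F.plug c p.1 := by
  obtain ⟨i, φ, hφ⟩ := exists_mk_eq (F := F) (F.behaviours.str z)
  obtain ⟨u, hu⟩ := exists_eq_of_mem_successors hφ hp
  refine ⟨⟨i, Quotient.mk _ ⟨u, fun v => φ v.1⟩⟩, ⟨i, _, rfl, fun v => ?_⟩, ?_⟩
  · by_contra hv
    by_cases hvu : φ v.1 = φ u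
    · have := F.finite_U i
      -- The fibre of `φ` over `φ u` has two elements, so `(φ u, 1)` is a successor as well.
      refine hz ⟨(φ u, 0), zero_mem_successors hφ u, (φ u, 1), ?_, by simp, hu ▸ hpn, hu ▸ hpn⟩
      rw [mem_successors_iff hφ]
      exact Finite.one_lt_card_iff_nontrivial.2
        ⟨⟨v.1, hvu⟩, ⟨u, rfl⟩, fun h => v.2 (congrArg Subtype.val h)⟩
    · exact hz ⟨_, zero_mem_successors hφ v.1, _, zero_mem_successors hφ u,
        fun h => hvu (congrArg Prod.fst h), hv, hu ▸ hpn⟩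
  · rw [hφ, ← hu]
    exact congrArg (fun ψ => (⟨i, Quotient.mk _ ψ⟩ : F.Obj F.behaviours.V))
      (fill_restrict φ u).symm

theorem mem_constructible_of_thin {z : F.behaviours.V} (hz : Thin F.behaviours z) :
    z ∈ F.constructible := by
  by_contra hzn
  have hex : ∀ z : F.behaviours.V, ∃ σ : Bool → F.behaviours.V × ℕ, z ∉ F.constructible →
      (∀ b, (σ b).1 ∉ F.constructible) ∧ (∀ b, σ b ∈ successors F.behaviours z) ∧
        (Splits z → σ false ≠ σ true) := by
    intro z
    by_cases hs : Splits z
    · obtain ⟨p, hp, q, hq, hne, hpn, hqn⟩ := hs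
      refine ⟨fun b => cond b q p, fun _ => ⟨?_, ?_, fun _ => hne⟩⟩
      · rintro (_ | _) <;> assumption
      · rintro (_ | _) <;> assumption
    · by_cases hz : z ∈ F.constructible
      · exact ⟨fun _ => (z, 0), fun h => absurd hz h⟩
      · obtain ⟨p, hp, hpn⟩ := exists_successor_not_constructible hz
        exact ⟨fun _ => p, fun _ => ⟨fun _ => hpn, fun _ => hp, fun h => absurd h hs⟩⟩
  choose σ hσ using hex
  refine not_thin_of_steer (T := F.behaviours) (Split := Splits) (N := (· ∉ F.constructible))
    (σ := σ) (fun z hz => (hσ z hz).1) (fun z hz => (hσ z hz).2.1)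
    (fun z hz => (hσ z hz).2.2) ?_ hzn hz
  intro z hz
  -- Without a splitting behaviour on the chosen path, `z` is `β₁` of constructible contexts.
  by_contra! hns
  have hN : ∀ n, (fun z => (σ z false).1)^[n] z ∉ F.constructible := by
    intro n
    induction n with
    | zero => exact hz
    | succ n ih =>
      rw [Function.iterate_succ_apply']
      exact (hσ _ ih).1 false
  choose c hc hplug using fun n => exists_plug_of_not_splits (hns n)
    ((hσ _ (hN n)).2.1 false) ((hσ _ (hN n)).1 false)
  refine hz ?_
  have : z = F.beta₁ c := eq_beta₁_of_forall_plug
    (z := fun n => (fun z => (σ z false).1)^[n] z) fun n => by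
      rw [Function.iterate_succ_apply']
      exact hplug n
  rw [this]
  exact beta₁_mem_constructible hc

theorem thinBehaviours_eq_constructible (F : AnalyticFunctor.{u}) :
    F.thinBehaviours = F.constructible := by
  refine Set.Subset.antisymm (fun z hz => mem_constructible_of_thin hz) ?_
  rintro _ ⟨a, rfl⟩
  exact thin_operational a

end AnalyticFunctor

theorem mainTheorem1 (F : AnalyticFunctor.{u}) :
    Nonempty (F.constructibleAlgebra ≅ F.quotientTerms) ∧
    F.thinBehaviours = F.constructible ∧
    ∃ (hthin : AnalyticFunctor.IsClosedUnder F.behavioursAlgebra F.thinBehaviours)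
      (hcoh : AnalyticFunctor.Coherent
        (AnalyticFunctor.subalgebra F.behavioursAlgebra F.thinBehaviours hthin)),
      Nonempty (Limits.IsInitial
        (⟨AnalyticFunctor.subalgebra F.behavioursAlgebra F.thinBehaviours hthin, hcoh⟩ :
          AnalyticFunctor.CoherentAlgebra F)) := by
  have h := F.thinBehaviours_eq_constructible
  refine ⟨AnalyticFunctor.nonempty_constructibleAlgebra_iso_quotientTerms, h, ?_⟩
  rw [h]
  exact ⟨F.constructible_isClosedUnder,
    AnalyticFunctor.coherent_subalgebra AnalyticFunctor.coherent_behavioursAlgebra _ _,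
    AnalyticFunctor.nonempty_isInitial_constructible _⟩
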